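/- Let $L\ge 1$ and let $K=\bigcup_{\ell=1}^L[a_\ell,b_\ell]$ with $-1=a_1<b_1<a_2<b_2<\cdots<a_L<b_L=1$. Let $w:K\to\mathbb{R}$ be continuous and positive, and let $N\ge 0$ be an integer. For a polynomial $P$ with real coefficients and degree at most $N$, put $$\Big\|\frac{P}{w}\Big\|_{L_1(K)}=\int_K\frac{|P(t)|}{w(t)}\,dt .$$ For a function $f$ on $[a_\ell,b_\ell]$ write $f_\ell(x)=f\big(\tfrac{(b_\ell-a_\ell)x+a_\ell+b_\ell}{2}\big)$, $x\in[-1,1]$, and let $T_n$, $U_n$ denote the Chebyshev polynomials of the first and second kind. Write $P=\sum_{n=0}^N p_nT_n$ and $\mathbf{p}=(p_0,\dots,p_N)$, and let $\mathbf{W}^\ell\in\mathbb{R}^{(N+1)\times(N+1)}$ be the matrix for which $P_\ell=\sum_{n=0}^N(\mathbf{W}^\ell\mathbf{p})_nU_n$ for all such $P$. For $d\ge 0$ let $\mathbf{J}^{\ell,d}\in\mathbb{R}^{(d+1)\times(N+1)}$ have the entries $$J^{\ell,d}_{k,n}=\int_0^\pi\frac{\cos(k\theta)\sin((n+1)\theta)}{w_\ell(\cos\theta)}\,d\theta,\qquad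 0\le k\le d,\ 0\le n\le N,$$ and for $\mathbf{y}=(y_0,\dots,y_d)\in\mathbb{R}^{d+1}$ let $\mathrm{Toep}_d(\mathbf{y})=(y_{|i-j|})_{0\le i,j\le d}$. Define $$|\!|\!|P|\!|\!|_d:=\min\ \sum_{\ell=1}^L\frac{b_\ell-a_\ell}{2}\,(y_0^{\ell,+}+y_0^{\ell,-}),$$ where the minimum is over all $\mathbf{y}^{1,\pm},\dots,\mathbf{y}^{L,\pm}\in\mathbb{R}^{d+1}$ such that, for every $\ell$, $\mathbf{y}^{\ell,+}-\mathbf{y}^{\ell,-}=\mathbf{J}^{\ell,d}\mathbf{W}^\ell\mathbf{p}$ and the matrices $\mathrm{Toep}_d(\mathbf{y}^{\ell,+})$ and $\mathrm{Toep}_d(\mathbf{y}^{\ell,-})$ are positive semidefinite. Then, for each $d\ge N$, this minimum is attained for every $P$ of degree at most $N$, and $|\!|\!|\cdot|\!|\!|_d$ is a norm on the space of real polynomials of degree at most $N$. Moreover, for every $P$ of degree at most $N$ and every $d\ge N$, $$|\!|\!|P|\!|\!|_d\le|\!|\!|P|\!|\!|_{d+1}\le\Big\|\frac{P}{w}\Big\|_{L_1(K)},\qquad\text{and}\qquad\lim_{d\to\infty}|\!|\!|P|\!|\!|_d=\Big\|\frac{P}{w}\Big\|_{L_1(K)}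 .$$ -/

import Mathlib

open Polynomial Filter Topology

/-- A disjoint union of `L ≥ 1` nondegenerate compact intervals
`K = ⋃ₗ [aₗ, bₗ]` with `-1 = a₁ < b₁ < a₂ < b₂ < ⋯ < a_L < b_L = 1`. -/
structure IntervalUnion (L : ℕ) where
  pos : 0 < L
  a : Fin L → ℝ
  b : Fin L → ℝ
  a_lt_b : ∀ l, a l < b l
  b_lt_a : ∀ l m, l < m → b l < a m
  a_first : a ⟨0, pos⟩ = -1
  b_last : b ⟨L - 1, Nat.sub_lt pos Nat.one_pos⟩ = 1

namespace IntervalUnion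

variable {L : ℕ}

/-- The set `K` itself. -/
def carrier (K : IntervalUnion L) : Set ℝ := ⋃ l, Set.Icc (K.a l) (K.b l)

/-- The weighted norm `‖P / w‖_{L₁(K)}`. -/
noncomputable def weightedL1Norm (K : IntervalUnion L) (w : ℝ → ℝ) (P : ℝ[X]) : ℝ :=
  ∫ t in K.carrier, |P.eval t / w t|

/-- The polynomial `Pₗ(x) = P (((bₗ - aₗ) x + aₗ + bₗ) / 2)`. -/
noncomputable def transplantPoly (K : IntervalUnion L) (l : Fin L) (P : ℝ[X]) : ℝ[X] :=
  P.comp (C ((K.b l - K.a l) / 2) * X + C ((K.a l + K.b l) / 2))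

/-- The weight `wₗ(x) = w (((bₗ - aₗ) x + aₗ + bₗ) / 2)`. -/
noncomputable def transplantWeight (K : IntervalUnion L) (l : Fin L) (w : ℝ → ℝ) (x : ℝ) : ℝ :=
  w (((K.b l - K.a l) * x + K.a l + K.b l) / 2)

end IntervalUnion

/-- The basis `T₀, T₁, …` of `ℝ[X]` (Chebyshev polynomials of the first kind). -/
noncomputable def chebTBasis : Module.Basis ℕ ℝ ℝ[X] :=
  (Chebyshev.chebyshevTsequence ℝ).basis
    fun i => isUnit_iff_ne_zero.mpr
      (leadingCoeff_ne_zero.mpr ((Chebyshev.chebyshevTsequence ℝ).ne_zero i))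

theorem chebTBasis_apply (n : ℕ) : chebTBasis n = Chebyshev.T ℝ n := by
  simp [chebTBasis, Polynomial.Sequence.basis, Chebyshev.chebyshevTsequence]

/-- The sequence `U₀, U₁, …` (Chebyshev polynomials of the second kind). -/
noncomputable def chebUSequence : Polynomial.Sequence ℝ where
  elems' n := Chebyshev.U ℝ n
  degree_eq' n := Chebyshev.degree_U_natCast ℝ n

/-- The basis `U₀, U₁, …` of `ℝ[X]` (Chebyshev polynomials of the second kind). -/
noncomputable def chebUBasis : Module.Basis ℕ ℝ ℝ[X] :=
  chebUSequence.basis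
    fun i => isUnit_iff_ne_zero.mpr (leadingCoeff_ne_zero.mpr (chebUSequence.ne_zero i))

theorem chebUBasis_apply (n : ℕ) : chebUBasis n = Chebyshev.U ℝ n := by
  simp [chebUBasis, Polynomial.Sequence.basis, chebUSequence]

/-- The Chebyshev coefficients `p₀, …, p_N` of `P`, i.e. `P = ∑ₙ pₙ Tₙ` when `deg P ≤ N`. -/
noncomputable def chebTCoeffs (N : ℕ) (P : ℝ[X]) : Fin (N + 1) → ℝ :=
  fun n => chebTBasis.repr P n

/-- The symmetric Toeplitz matrix `Toep_d(y)`, with entry `y_{|i-j|}` in position `(i, j)`. -/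
def toeplitz (d : ℕ) (y : Fin (d + 1) → ℝ) : Matrix (Fin (d + 1)) (Fin (d + 1)) ℝ :=
  Matrix.of fun i j => y ⟨max i.1 j.1 - min i.1 j.1, by omega⟩

namespace IntervalUnion

variable {L : ℕ}

/-- The matrix `Wˡ` of the linear map taking the first-kind Chebyshev coefficients of `P` to the
second-kind Chebyshev coefficients of `Pₗ`: its `n`-th column holds the coefficients of the
transplant of `Tₙ` in the basis `U₀, …, U_N`. -/
noncomputable def W (K : IntervalUnion L) (N : ℕ) (l : Fin L) :
    Matrix (Fin (N + 1)) (Fin (N + 1)) ℝ :=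
  Matrix.of fun m n => chebUBasis.repr (K.transplantPoly l (Chebyshev.T ℝ n)) m

/-- The matrix `J^{l,d}`, with entries
`∫₀^π cos(kθ) sin((n+1)θ) / wₗ(cos θ) dθ` for `0 ≤ k ≤ d` and `0 ≤ n ≤ N`. -/
noncomputable def J (K : IntervalUnion L) (w : ℝ → ℝ) (N d : ℕ) (l : Fin L) :
    Matrix (Fin (d + 1)) (Fin (N + 1)) ℝ :=
  Matrix.of fun k n => ∫ θ in (0 : ℝ)..Real.pi,
    Real.cos ((k : ℝ) * θ) * Real.sin (((n : ℝ) + 1) * θ) /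
      K.transplantWeight l w (Real.cos θ)

/-- The feasible pairs of families `(y^{1,+}, …, y^{L,+})`, `(y^{1,-}, …, y^{L,-})` of vectors of
`ℝ^{d+1}`. -/
def Feasible (K : IntervalUnion L) (w : ℝ → ℝ) (N d : ℕ) (P : ℝ[X])
    (yp ym : Fin L → Fin (d + 1) → ℝ) : Prop :=
  ∀ l, yp l - ym l = (K.J w N d l).mulVec ((K.W N l).mulVec (chebTCoeffs N P)) ∧
    (toeplitz d (yp l)).PosSemidef ∧ (toeplitz d (ym l)).PosSemidef

/-- The objective function `∑ₗ (bₗ - aₗ)/2 · (y₀^{l,+} + y₀^{l,-})`. -/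
noncomputable def objective (K : IntervalUnion L) (d : ℕ) (yp ym : Fin L → Fin (d + 1) → ℝ) : ℝ :=
  ∑ l, (K.b l - K.a l) / 2 * (yp l 0 + ym l 0)

/-- The set of objective values at feasible points. -/
def feasibleValues (K : IntervalUnion L) (w : ℝ → ℝ) (N d : ℕ) (P : ℝ[X]) : Set ℝ :=
  {v | ∃ yp ym : Fin L → Fin (d + 1) → ℝ, K.Feasible w N d P yp ym ∧ v = K.objective d yp ym}

/-- The value of the truncated semidefinite program at level `d`. -/
noncomputable def ersatzNorm (K : IntervalUnion L) (w : ℝ → ℝ) (N d : ℕ) (P : ℝ[X]) : ℝ :=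
  sInf (K.feasibleValues w N d P)

end IntervalUnion

/-- `ν` is a norm on the real vector space `V`. -/
structure IsVectorNorm {V : Type*} [AddCommGroup V] [Module ℝ V] (ν : V → ℝ) : Prop where
  nonneg : ∀ x, 0 ≤ ν x
  eq_zero_iff : ∀ x, ν x = 0 ↔ x = 0
  smul : ∀ (c : ℝ) x, ν (c • x) = |c| * ν x
  add_le : ∀ x y, ν (x + y) ≤ ν x + ν y

/-! Put x = cos θ and let gₗ(θ) = (Pₗ/wₗ)(cos θ) sin θ. Since Uₙ(cos θ) sin θ = sin((n+1)θ), the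
vector Jˡ Wˡ p lists the cosine moments of gₗ on [0, π] (`J_mulVec_W_mulVec`), while ‖P/w‖ is the
sum over l of (bₗ - aₗ)/2 · ∫|gₗ| (`weightedL1Norm_eq_sum`). The program thus relaxes the splitting
of gₗ dθ into two positive measures, keeping only d+1 moments of each.

Upper bound and monotonicity: the moments of the positive and negative parts of gₗ are feasible with
value ‖P/w‖ (`exists_toeplitz_posSemidef_cosMoment`), and deleting the last moment keeps feasibility
(`Feasible.truncate`). A positive semidefinite Toeplitz matrix has |yₖ| ≤ y₀, so sublevel sets are
compact and the minimum is attained (`isLeast_ersatzNorm`). The same bound shows that value zero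
kills the moments; for d ≥ N these suffice to pair gₗ with Pₗ(cos θ), which forces P = 0
(`eq_zero_of_J_mulVec_eq_zero`).

Limit: choose a polynomial Q with |Q| ≤ 1 on [-1, 1] and ∫ Q(cos θ) gₗ close to ∫|gₗ|. Pairing Q(cos
θ) with the nonnegative trigonometric polynomial ∑ y_{|i-j|} cos((i-j)θ) gives at most π(d+1)y₀ in
absolute value. Subtracting the pairings for y⁺ and y⁻ leaves only moments of gₗ, and after division
by d+1 a Cesàro mean of partial Parseval sums, which tends to π ∫ Q(cos θ) gₗ
(`eventually_integral_eval_cos_mul_sub_le`). -/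

/-! ### Positive semidefinite Toeplitz matrices and cosine moments -/

/-- The `k`-th cosine moment of `g` over `[0, π]`. -/
noncomputable def cosMoment (g : ℝ → ℝ) (k : ℕ) : ℝ :=
  ∫ θ in (0 : ℝ)..Real.pi, Real.cos (k * θ) * g θ

theorem toeplitz_posSemidef_iff (d : ℕ) (y : Fin (d + 1) → ℝ) :
    (toeplitz d y).PosSemidef ↔
      ∀ x : Fin (d + 1) → ℝ, 0 ≤ ∑ i, ∑ j, x i * x j * toeplitz d y i j := by
  rw [Matrix.posSemidef_iff_dotProduct_mulVec]
  have hH : (toeplitz d y).IsHermitian := by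
    ext i j
    simp [toeplitz, max_comm, min_comm]
  have hsum : ∀ x : Fin (d + 1) → ℝ, dotProduct (star x) ((toeplitz d y).mulVec x) =
      ∑ i, ∑ j, x i * x j * toeplitz d y i j := by
    intro x
    simp only [dotProduct, Matrix.mulVec, Finset.mul_sum, star_trivial]
    exact Finset.sum_congr rfl fun i _ => Finset.sum_congr rfl fun j _ => by ring
  simp only [hsum]
  exact ⟨fun h => h.2, fun h => ⟨hH, h⟩⟩

theorem cos_max_sub_min_mul (i j : ℕ) (θ : ℝ) :
    Real.cos (((max i j - min i j : ℕ) : ℝ) * θ) =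
      Real.cos (i * θ) * Real.cos (j * θ) + Real.sin (i * θ) * Real.sin (j * θ) := by
  rw [← Real.cos_sub, Nat.cast_sub (min_le_max)]
  rcases le_total i j with h | h
  · rw [max_eq_right h, min_eq_left h, ← Real.cos_neg]; congr 1; ring
  · rw [max_eq_left h, min_eq_right h]; congr 1; ring

/-- The principal minor on rows 0 and k is y₀² - yₖ². -/
theorem abs_apply_le_of_toeplitz_posSemidef {d : ℕ} {y : Fin (d + 1) → ℝ}
    (h : (toeplitz d y).PosSemidef) (k : Fin (d + 1)) : |y k| ≤ y 0 := by
  have h0 : 0 ≤ y 0 := by simpa [toeplitz] using h.diag_nonneg (i := 0)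
  have h2 := (h.submatrix ![0, k]).det_nonneg
  rw [Matrix.det_fin_two] at h2
  simp [toeplitz] at h2
  exact abs_le_of_sq_le_sq (by nlinarith) h0

theorem isClosed_setOf_toeplitz_posSemidef (d : ℕ) :
    IsClosed {y : Fin (d + 1) → ℝ | (toeplitz d y).PosSemidef} := by
  simp only [toeplitz_posSemidef_iff, Set.ofPred_forall]
  refine isClosed_iInter fun x => isClosed_le continuous_const ?_
  refine continuous_finsetSum _ fun i _ => continuous_finsetSum _ fun j _ => ?_
  exact continuous_const.mul (continuous_apply _)

/-- The quadratic form at x is the integral of |∑ xⱼ e^{ijθ}|² against g. -/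
theorem toeplitz_cosMoment_posSemidef {g : ℝ → ℝ} (hg : ContinuousOn g (Set.uIcc 0 Real.pi))
    (hg0 : ∀ θ ∈ Set.Icc 0 Real.pi, 0 ≤ g θ) (d : ℕ) :
    (toeplitz d (fun k => cosMoment g k)).PosSemidef := by
  rw [toeplitz_posSemidef_iff]
  intro x
  have key : ∑ i, ∑ j, x i * x j * toeplitz d (fun k => cosMoment g k) i j =
      ∫ θ in (0 : ℝ)..Real.pi, ((∑ i : Fin (d + 1), x i * Real.cos (i * θ)) ^ 2 +
        (∑ i : Fin (d + 1), x i * Real.sin (i * θ)) ^ 2) * g θ := by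
    have : ∀ θ, ((∑ i : Fin (d + 1), x i * Real.cos (i * θ)) ^ 2 +
        (∑ i : Fin (d + 1), x i * Real.sin (i * θ)) ^ 2) * g θ =
        ∑ i : Fin (d + 1), ∑ j : Fin (d + 1), x i * x j *
          (Real.cos (((max i.1 j.1 - min i.1 j.1 : ℕ) : ℝ) * θ) * g θ) := by
      intro θ
      rw [sq, sq, Finset.sum_mul_sum, Finset.sum_mul_sum, ← Finset.sum_add_distrib, Finset.sum_mul]
      refine Finset.sum_congr rfl fun i _ => ?_
      rw [← Finset.sum_add_distrib, Finset.sum_mul]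
      refine Finset.sum_congr rfl fun j _ => ?_
      rw [cos_max_sub_min_mul]
      ring
    simp only [this]
    have hint : ∀ i j : Fin (d + 1), IntervalIntegrable (fun θ => x i * x j *
          (Real.cos (((max i.1 j.1 - min i.1 j.1 : ℕ) : ℝ) * θ) * g θ)) MeasureTheory.volume
          0 Real.pi := fun i j => ContinuousOn.intervalIntegrable (by fun_prop)
    rw [intervalIntegral.integral_finsetSum fun i _ =>
      ContinuousOn.intervalIntegrable (by fun_prop)]
    refine Finset.sum_congr rfl fun i _ => ?_
    rw [intervalIntegral.integral_finsetSum fun j _ => hint i j]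
    refine Finset.sum_congr rfl fun j _ => ?_
    rw [intervalIntegral.integral_const_mul]
    rfl
  rw [key]
  exact intervalIntegral.integral_nonneg Real.pi_pos.le fun θ hθ =>
    mul_nonneg (by positivity) (hg0 θ hθ)

/-! ### Cosine orthogonality, Parseval and Cesàro sums -/

theorem integral_cos_int_mul (n : ℤ) :
    ∫ θ in (0 : ℝ)..Real.pi, Real.cos (n * θ) = if n = 0 then Real.pi else 0 := by
  split_ifs with h
  · simp [h]
  · have : (n : ℝ) ≠ 0 := by exact_mod_cast h
    rw [intervalIntegral.integral_comp_mul_left (fun x => Real.cos x) this]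
    simp [Real.sin_int_mul_pi]

theorem integral_cos_mul_cos (m k : ℕ) :
    ∫ θ in (0 : ℝ)..Real.pi, Real.cos (m * θ) * Real.cos (k * θ) =
      if m = k then (if k = 0 then Real.pi else Real.pi / 2) else 0 := by
  have h : ∀ θ : ℝ, Real.cos (m * θ) * Real.cos (k * θ) =
      (1 / 2) * (Real.cos (((m - k : ℤ) : ℝ) * θ) + Real.cos (((m + k : ℤ) : ℝ) * θ)) := by
    intro θ
    push_cast
    rw [sub_mul, add_mul, Real.cos_sub, Real.cos_add]
    ring
  simp only [h]
  rw [intervalIntegral.integral_const_mul, intervalIntegral.integral_add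
    (Continuous.intervalIntegrable (by fun_prop) _ _)
    (Continuous.intervalIntegrable (by fun_prop) _ _), integral_cos_int_mul, integral_cos_int_mul]
  by_cases hmk : m = k
  · subst hmk
    by_cases h0 : m = 0
    · simp [h0]; ring
    · have : (m : ℤ) + m ≠ 0 := by omega
      simp [h0]; ring
  · have h1 : (m : ℤ) - k ≠ 0 := by omega
    have h2 : (m : ℤ) + k ≠ 0 := by omega
    simp [hmk, h1, h2]

/-- Summation of a function of `|i - j|` over a square. -/
theorem sum_range_sum_range_dist (a : ℕ → ℝ) (n : ℕ) :
    ∑ i ∈ Finset.range n, ∑ j ∈ Finset.range n, a (max i j - min i j) =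
      ∑ m ∈ Finset.range n, (a 0 + 2 * ∑ k ∈ Finset.range m, a (k + 1)) := by
  induction n with
  | zero => simp
  | succ n ih =>
    -- The new row and the new column each contribute a(1) + ... + a(n); the corner contributes
    -- a(0).
    have h1 : ∑ j ∈ Finset.range n, a (max n j - min n j) = ∑ k ∈ Finset.range n, a (k + 1) := by
      rw [← Finset.sum_range_reflect]
      refine Finset.sum_congr rfl fun j hj => ?_
      have := Finset.mem_range.mp hj
      congr 1; omega
    have h2 : ∑ i ∈ Finset.range n, a (max i n - min i n) = ∑ k ∈ Finset.range n, a (k + 1) := by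
      rw [← h1]
      exact Finset.sum_congr rfl fun j _ => by rw [max_comm, min_comm]
    rw [Finset.sum_range_succ (fun m => a 0 + 2 * ∑ k ∈ Finset.range m, a (k + 1)), ← ih]
    simp only [Finset.sum_range_succ _ n, Finset.sum_add_distrib]
    rw [h1, h2]
    simp only [max_self, min_self, Nat.sub_self]
    ring


/-- Partial Parseval sums for cosine series, against a polynomial in `cos θ`. -/
theorem tendsto_cosMoment_mul_cosMoment (Q : ℝ[X]) {g : ℝ → ℝ}
    (hg : ContinuousOn g (Set.uIcc 0 Real.pi)) :
    Tendsto (fun n : ℕ => cosMoment (fun θ => Q.eval (Real.cos θ)) 0 * cosMoment g 0 +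
      2 * ∑ k ∈ Finset.range n,
        cosMoment (fun θ => Q.eval (Real.cos θ)) (k + 1) * cosMoment g (k + 1)) atTop
      (𝓝 (Real.pi * ∫ θ in (0 : ℝ)..Real.pi, Q.eval (Real.cos θ) * g θ)) := by
  -- Both sides are linear in Q, so it suffices to treat Tₘ, for which the partial sums are constant
  -- once n ≥ m.
  have hQ : Q ∈ Submodule.span ℝ (Set.range chebTBasis) := by
    rw [chebTBasis.span_eq]; trivial
  induction hQ using Submodule.span_induction with
  | mem Q hQ =>
    obtain ⟨m, rfl⟩ := hQ
    have hm : ∀ k, cosMoment (fun θ => (chebTBasis m).eval (Real.cos θ)) k =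
        if m = k then (if k = 0 then Real.pi else Real.pi / 2) else 0 := by
      intro k
      rw [← integral_cos_mul_cos, cosMoment]
      congr 1
      ext θ
      rw [chebTBasis_apply, Chebyshev.T_real_cos, mul_comm]
      simp
    have hi : ∫ θ in (0 : ℝ)..Real.pi, (chebTBasis m).eval (Real.cos θ) * g θ =
        cosMoment g m := by
      simp [cosMoment, chebTBasis_apply, Chebyshev.T_real_cos]
    rw [hi]
    refine tendsto_const_nhds.congr' ?_
    filter_upwards [eventually_ge_atTop m] with n hn
    simp only [hm]
    rcases m with _ | m
    · simp
    · have : m ∈ Finset.range n := Finset.mem_range.mpr (by omega)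
      simp [Finset.sum_ite_eq, this]
      ring
  | zero => simp [cosMoment]
  | add Q R _ _ hQ hR =>
    have hadd : ∀ k, cosMoment (fun θ => (Q + R).eval (Real.cos θ)) k =
        cosMoment (fun θ => Q.eval (Real.cos θ)) k + cosMoment (fun θ => R.eval (Real.cos θ)) k := by
      intro k
      simp only [cosMoment, eval_add, mul_add]
      exact intervalIntegral.integral_add (Continuous.intervalIntegrable (by fun_prop) _ _)
        (Continuous.intervalIntegrable (by fun_prop) _ _)
    have hi : ∫ θ in (0 : ℝ)..Real.pi, (Q + R).eval (Real.cos θ) * g θ =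
        (∫ θ in (0 : ℝ)..Real.pi, Q.eval (Real.cos θ) * g θ) +
          ∫ θ in (0 : ℝ)..Real.pi, R.eval (Real.cos θ) * g θ := by
      simp only [eval_add, add_mul]
      exact intervalIntegral.integral_add (ContinuousOn.intervalIntegrable (by fun_prop))
        (ContinuousOn.intervalIntegrable (by fun_prop))
    rw [hi, mul_add]
    refine (hQ.add hR).congr fun n => ?_
    simp only [hadd, add_mul, Finset.sum_add_distrib]
    ring
  | smul c Q _ hQ =>
    have hsmul : ∀ k, cosMoment (fun θ => (c • Q).eval (Real.cos θ)) k =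
        c * cosMoment (fun θ => Q.eval (Real.cos θ)) k := by
      intro k
      simp only [cosMoment, eval_smul, smul_eq_mul, mul_left_comm _ c]
      exact intervalIntegral.integral_const_mul _ _
    have hi : ∫ θ in (0 : ℝ)..Real.pi, (c • Q).eval (Real.cos θ) * g θ =
        c * ∫ θ in (0 : ℝ)..Real.pi, Q.eval (Real.cos θ) * g θ := by
      simp only [eval_smul, smul_eq_mul, mul_assoc c]
      exact intervalIntegral.integral_const_mul _ _
    rw [hi, mul_left_comm]
    refine (hQ.const_mul c).congr fun n => ?_
    simp only [hsmul, mul_assoc c, ← Finset.mul_sum]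
    ring

/-! ### Duality on a single interval -/

/-- Testing a positive semidefinite Toeplitz matrix against a bounded even function. -/
theorem abs_sum_cosMoment_mul_toeplitz_le {d : ℕ} {y : Fin (d + 1) → ℝ}
    (hy : (toeplitz d y).PosSemidef) {q : ℝ → ℝ} (hq : Continuous q) (hq1 : ∀ θ, |q θ| ≤ 1) :
    |∑ i : Fin (d + 1), ∑ j : Fin (d + 1),
      cosMoment q (max i.1 j.1 - min i.1 j.1) * toeplitz d y i j| ≤
      Real.pi * ((d + 1) * y 0) := by
  set f : ℝ → ℝ := fun θ => ∑ i : Fin (d + 1), ∑ j : Fin (d + 1),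
    Real.cos (((max i.1 j.1 - min i.1 j.1 : ℕ) : ℝ) * θ) * toeplitz d y i j with hf
  have hfc : Continuous f := by fun_prop
  have hf0 : ∀ θ, 0 ≤ f θ := by
    intro θ
    -- Since cos((i-j)θ) = cos iθ cos jθ + sin iθ sin jθ, f(θ) is the sum of two values of the
    -- quadratic form.
    have h1 := (toeplitz_posSemidef_iff d y).1 hy fun i => Real.cos (i * θ)
    have h2 := (toeplitz_posSemidef_iff d y).1 hy fun i => Real.sin (i * θ)
    refine (add_nonneg h1 h2).trans_eq ?_
    simp only [hf, ← Finset.sum_add_distrib, cos_max_sub_min_mul]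
    exact Finset.sum_congr rfl fun i _ => Finset.sum_congr rfl fun j _ => by ring
  have hI : ∀ p : ℝ → ℝ, Continuous p → ∫ θ in (0 : ℝ)..Real.pi, p θ * f θ =
      ∑ i : Fin (d + 1), ∑ j : Fin (d + 1),
        cosMoment p (max i.1 j.1 - min i.1 j.1) * toeplitz d y i j := by
    intro p hp
    simp only [hf, Finset.mul_sum]
    rw [intervalIntegral.integral_finsetSum fun i _ =>
      Continuous.intervalIntegrable (by fun_prop) _ _]
    refine Finset.sum_congr rfl fun i _ => ?_
    rw [intervalIntegral.integral_finsetSum fun j _ =>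
      Continuous.intervalIntegrable (by fun_prop) _ _]
    refine Finset.sum_congr rfl fun j _ => ?_
    rw [cosMoment, ← intervalIntegral.integral_mul_const]
    congr 1
    ext θ
    ring
  -- Only the d+1 diagonal entries survive integration.
  have h1 : ∫ θ in (0 : ℝ)..Real.pi, f θ = Real.pi * ((d + 1) * y 0) := by
    have h := hI (fun _ => 1) continuous_const
    simp only [one_mul] at h
    rw [h]
    have hc : ∀ k, cosMoment (fun _ => 1) k = if k = 0 then Real.pi else 0 := by
      intro k
      have := integral_cos_int_mul k
      simpa [cosMoment] using this
    have hij : ∀ i j : Fin (d + 1), cosMoment (fun _ => 1) (max i.1 j.1 - min i.1 j.1) *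
        toeplitz d y i j = if i = j then Real.pi * y 0 else 0 := by
      intro i j
      rw [hc]
      by_cases h : i = j
      · subst h; simp [toeplitz]
      · have : max i.1 j.1 - min i.1 j.1 ≠ 0 := by
          have := Fin.val_ne_of_ne h
          omega
        simp only [this, h, if_false, zero_mul]
    simp only [hij]
    simp
    ring
  rw [← hI q hq, ← h1]
  calc |∫ θ in (0 : ℝ)..Real.pi, q θ * f θ| ≤ ∫ θ in (0 : ℝ)..Real.pi, |q θ * f θ| :=
        intervalIntegral.abs_integral_le_integral_abs Real.pi_pos.le
    _ ≤ ∫ θ in (0 : ℝ)..Real.pi, f θ := by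
        refine intervalIntegral.integral_mono_on Real.pi_pos.le
          (Continuous.intervalIntegrable (by fun_prop) _ _) (hfc.intervalIntegrable _ _) ?_
        intro θ _
        rw [abs_mul, abs_of_nonneg (hf0 θ)]
        exact mul_le_of_le_one_left (hf0 θ) (hq1 θ)

/-- Asymptotic weak duality for the Toeplitz program of a single interval. -/
theorem eventually_integral_eval_cos_mul_sub_le {Q : ℝ[X]} (hQ : ∀ x ∈ Set.Icc (-1 : ℝ) 1,
    |Q.eval x| ≤ 1) {g : ℝ → ℝ} (hg : ContinuousOn g (Set.uIcc 0 Real.pi)) {δ : ℝ} (hδ : 0 < δ) :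
    ∀ᶠ d : ℕ in atTop, ∀ yp ym : Fin (d + 1) → ℝ, (toeplitz d yp).PosSemidef →
      (toeplitz d ym).PosSemidef → (∀ k, yp k - ym k = cosMoment g k) →
      (∫ θ in (0 : ℝ)..Real.pi, Q.eval (Real.cos θ) * g θ) - δ ≤ yp 0 + ym 0 := by
  have h := (tendsto_cosMoment_mul_cosMoment Q hg).cesaro
  -- The index shift matches the matrix size d+1.
  have h2 := (tendsto_add_atTop_iff_nat 1).2 h
  have hpi := Real.pi_pos
  filter_upwards [h2.eventually_const_le (u := Real.pi *
    ((∫ θ in (0 : ℝ)..Real.pi, Q.eval (Real.cos θ) * g θ) - δ)) (by nlinarith)] with d hd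
  intro yp ym hp hm hv
  rw [← sum_range_sum_range_dist (fun k => cosMoment (fun θ => Q.eval (Real.cos θ)) k *
    cosMoment g k)] at hd
  set q : ℝ → ℝ := fun θ => Q.eval (Real.cos θ) with hq
  have hqc : Continuous q := by fun_prop
  have hq1 : ∀ θ, |q θ| ≤ 1 := fun θ => hQ _ (Real.cos_mem_Icc θ)
  have hP := (abs_le.1 (abs_sum_cosMoment_mul_toeplitz_le hp hqc hq1)).2
  have hM := (abs_le.1 (abs_sum_cosMoment_mul_toeplitz_le hm hqc hq1)).1
  have hE : ∑ i ∈ Finset.range (d + 1), ∑ j ∈ Finset.range (d + 1),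
      cosMoment q (max i j - min i j) * cosMoment g (max i j - min i j) =
      (∑ i : Fin (d + 1), ∑ j : Fin (d + 1),
        cosMoment q (max i.1 j.1 - min i.1 j.1) * toeplitz d yp i j) -
      ∑ i : Fin (d + 1), ∑ j : Fin (d + 1),
        cosMoment q (max i.1 j.1 - min i.1 j.1) * toeplitz d ym i j := by
    simp only [Finset.sum_range, ← Finset.sum_sub_distrib, ← mul_sub]
    refine Finset.sum_congr rfl fun i _ => Finset.sum_congr rfl fun j _ => ?_
    congr 1
    exact (hv ⟨max i.1 j.1 - min i.1 j.1, by omega⟩).symm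
  rw [hE, inv_mul_eq_div, le_div_iff₀ (by positivity)] at hd
  push_cast at hd
  have : (Real.pi * (d + 1)) * ((∫ θ in (0 : ℝ)..Real.pi, Q.eval (Real.cos θ) * g θ) - δ) ≤
      (Real.pi * (d + 1)) * (yp 0 + ym 0) := by
    simp only [hq] at *
    linarith
  exact le_of_mul_le_mul_left this (by positivity)

/-- The sign of F is smoothed to F/(|F|+ε), approximated by Weierstrass, then divided by 1+ε to
restore the bound 1. -/
theorem exists_polynomial_integral_ge {F : ℝ → ℝ} (hF : ContinuousOn F (Set.Icc (-1) 1))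
    {δ : ℝ} (hδ : 0 < δ) :
    ∃ Q : ℝ[X], (∀ x ∈ Set.Icc (-1 : ℝ) 1, |Q.eval x| ≤ 1) ∧
      (∫ θ in (0 : ℝ)..Real.pi, |F (Real.cos θ)| * Real.sin θ) - δ ≤
        ∫ θ in (0 : ℝ)..Real.pi, Q.eval (Real.cos θ) * (F (Real.cos θ) * Real.sin θ) := by
  have hFc : ContinuousOn (fun θ => F (Real.cos θ)) (Set.uIcc 0 Real.pi) :=
    hF.comp Real.continuous_cos.continuousOn fun θ _ => Real.cos_mem_Icc θ
  obtain ⟨B, hB⟩ := isCompact_Icc.exists_bound_of_continuousOn hF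
  have hB0 : 0 ≤ B := (norm_nonneg _).trans (hB 0 (by simp))
  have hpi := Real.pi_pos
  -- Smoothing costs at most ε pointwise, approximation and rescaling at most 2εB; integrating over
  -- [0, π] gives δ in all.
  set ε := δ / (Real.pi * (1 + 2 * B)) with hε
  have hε0 : 0 < ε := by positivity
  have hFe : ∀ x, 0 < |F x| + ε := fun x => by positivity
  obtain ⟨R, hR⟩ := exists_polynomial_near_of_continuousOn (-1) 1 (fun x => F x / (|F x| + ε))
    (hF.div (hF.abs.add continuousOn_const) fun x _ => (hFe x).ne') ε hε0
  have hh : ∀ x, |F x / (|F x| + ε)| ≤ 1 := fun x => by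
    rw [abs_div, abs_of_pos (hFe x), div_le_one (hFe x)]; linarith
  have hQ : ∀ x, ((C (1 + ε)⁻¹ * R).eval x) = R.eval x / (1 + ε) := fun x => by
    rw [eval_mul, eval_C, inv_mul_eq_div]
  refine ⟨C (1 + ε)⁻¹ * R, fun x hx => ?_, ?_⟩
  · rw [hQ, abs_div, abs_of_pos (by positivity : 0 < 1 + ε), div_le_one (by positivity)]
    have h1 := abs_add_le (R.eval x - F x / (|F x| + ε)) (F x / (|F x| + ε))
    rw [sub_add_cancel] at h1
    linarith [hR x hx, hh x]
  · have hpt : ∀ x ∈ Set.Icc (-1 : ℝ) 1, |F x| - (C (1 + ε)⁻¹ * R).eval x * F x ≤ ε * (1 + 2 * B) := by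
      intro x hx
      have h1 : |F x / (|F x| + ε) - (C (1 + ε)⁻¹ * R).eval x| ≤ 2 * ε := by
        have h1ε : (0 : ℝ) < 1 + ε := by positivity
        have e : F x / (|F x| + ε) - (C (1 + ε)⁻¹ * R).eval x =
          ((F x / (|F x| + ε) - R.eval x) + ε * (F x / (|F x| + ε))) / (1 + ε) := by
          rw [hQ]; field_simp; ring
        rw [e, abs_div, abs_of_pos h1ε, div_le_iff₀ h1ε]
        have h2 := abs_add_le (F x / (|F x| + ε) - R.eval x) (ε * (F x / (|F x| + ε)))
        rw [abs_mul, abs_of_pos hε0] at h2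
        have h3 := hR x hx
        rw [abs_sub_comm] at h3
        nlinarith [hh x]
      have h2 : |F x| - F x / (|F x| + ε) * F x ≤ ε := by
        have e : |F x| - F x / (|F x| + ε) * F x = ε * (|F x| / (|F x| + ε)) := by
          have := (hFe x).ne'
          field_simp
          nlinarith [sq_abs (F x)]
        rw [e]
        exact mul_le_of_le_one_right hε0.le ((div_le_one (hFe x)).2 (by linarith))
      have h3 : (F x / (|F x| + ε) - (C (1 + ε)⁻¹ * R).eval x) * F x ≤ 2 * ε * B := by
        refine (le_abs_self _).trans ?_
        rw [abs_mul]
        exact mul_le_mul h1 (hB x hx) (abs_nonneg _) (by positivity)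
      linarith
    have hsin : ∀ θ ∈ Set.Icc 0 Real.pi, |F (Real.cos θ)| * Real.sin θ -
        (C (1 + ε)⁻¹ * R).eval (Real.cos θ) * (F (Real.cos θ) * Real.sin θ) ≤
        ε * (1 + 2 * B) := by
      intro θ hθ
      have h := hpt _ (Real.cos_mem_Icc θ)
      have hs := Real.sin_nonneg_of_mem_Icc hθ
      have hs1 := Real.sin_le_one θ
      have hc : 0 ≤ ε * (1 + 2 * B) := by positivity
      nlinarith [mul_le_mul_of_nonneg_right h hs, mul_le_of_le_one_right hc hs1]
    have hi1 : IntervalIntegrable (fun θ => |F (Real.cos θ)| * Real.sin θ)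
        MeasureTheory.volume 0 Real.pi :=
      (hFc.abs.mul Real.continuous_sin.continuousOn).intervalIntegrable
    have hi2 : IntervalIntegrable (fun θ => (C (1 + ε)⁻¹ * R).eval (Real.cos θ) *
        (F (Real.cos θ) * Real.sin θ)) MeasureTheory.volume 0 Real.pi :=
      (((C (1 + ε)⁻¹ * R).continuous.comp Real.continuous_cos).continuousOn.mul
        (hFc.mul Real.continuous_sin.continuousOn)).intervalIntegrable
    have hm := intervalIntegral.integral_mono_on hpi.le (hi1.sub hi2)
      (intervalIntegrable_const (c := ε * (1 + 2 * B))) hsin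
    rw [intervalIntegral.integral_sub hi1 hi2, intervalIntegral.integral_const, smul_eq_mul,
      sub_zero] at hm
    have : Real.pi * (ε * (1 + 2 * B)) = δ := by
      rw [hε]; field_simp
    linarith

/-- Half of δ pays for replacing the sign of F by a polynomial, half for the finite level d. -/
theorem eventually_integral_abs_sub_le {F : ℝ → ℝ} (hF : ContinuousOn F (Set.Icc (-1) 1))
    {δ : ℝ} (hδ : 0 < δ) :
    ∀ᶠ d : ℕ in atTop, ∀ yp ym : Fin (d + 1) → ℝ, (toeplitz d yp).PosSemidef →
      (toeplitz d ym).PosSemidef →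
      (∀ k, yp k - ym k = cosMoment (fun θ => F (Real.cos θ) * Real.sin θ) k) →
      (∫ θ in (0 : ℝ)..Real.pi, |F (Real.cos θ)| * Real.sin θ) - δ ≤ yp 0 + ym 0 := by
  obtain ⟨Q, hQ1, hQ⟩ := exists_polynomial_integral_ge hF (half_pos hδ)
  have hFc : ContinuousOn (fun θ => F (Real.cos θ)) (Set.uIcc 0 Real.pi) :=
    hF.comp Real.continuous_cos.continuousOn fun θ _ => Real.cos_mem_Icc θ
  filter_upwards [eventually_integral_eval_cos_mul_sub_le hQ1
    (g := fun θ => F (Real.cos θ) * Real.sin θ)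
    (hFc.mul Real.continuous_sin.continuousOn) (half_pos hδ)] with d hd
  intro yp ym hp hm hv
  linarith [hd yp ym hp hm hv]

/-- The witnesses are the moments of the positive and negative parts of F(cos θ), weighted by sin θ
≥ 0. -/
theorem exists_toeplitz_posSemidef_cosMoment {F : ℝ → ℝ}
    (hF : ContinuousOn F (Set.Icc (-1) 1)) (d : ℕ) :
    ∃ yp ym : Fin (d + 1) → ℝ, (toeplitz d yp).PosSemidef ∧ (toeplitz d ym).PosSemidef ∧
      (∀ k, yp k - ym k = cosMoment (fun θ => F (Real.cos θ) * Real.sin θ) k) ∧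
      yp 0 + ym 0 = ∫ θ in (0 : ℝ)..Real.pi, |F (Real.cos θ)| * Real.sin θ := by
  have hFc : ContinuousOn (fun θ => F (Real.cos θ)) (Set.uIcc 0 Real.pi) :=
    hF.comp Real.continuous_cos.continuousOn fun θ _ => Real.cos_mem_Icc θ
  have hmc : ContinuousOn (fun θ => max (-F (Real.cos θ)) 0) (Set.uIcc 0 Real.pi) :=
    hFc.neg.sup continuousOn_const
  have hpc : ContinuousOn (fun θ => max (F (Real.cos θ)) 0) (Set.uIcc 0 Real.pi) :=
    hFc.sup continuousOn_const
  have hps := hpc.mul Real.continuous_sin.continuousOn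
  have hms := hmc.mul Real.continuous_sin.continuousOn
  have hcos : ∀ k : ℕ, ContinuousOn (fun θ : ℝ => Real.cos (k * θ)) (Set.uIcc 0 Real.pi) :=
    fun k => by fun_prop
  have hpi : ∀ k : ℕ, IntervalIntegrable (fun θ => Real.cos (k * θ) *
      (max (F (Real.cos θ)) 0 * Real.sin θ)) MeasureTheory.volume 0 Real.pi :=
    fun k => ((hcos k).mul hps).intervalIntegrable
  have hmi : ∀ k : ℕ, IntervalIntegrable (fun θ => Real.cos (k * θ) *
      (max (-F (Real.cos θ)) 0 * Real.sin θ)) MeasureTheory.volume 0 Real.pi :=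
    fun k => ((hcos k).mul hms).intervalIntegrable
  refine ⟨fun k => cosMoment (fun θ => max (F (Real.cos θ)) 0 * Real.sin θ) k,
    fun k => cosMoment (fun θ => max (-F (Real.cos θ)) 0 * Real.sin θ) k, ?_, ?_, ?_, ?_⟩
  · exact toeplitz_cosMoment_posSemidef hps (fun θ hθ =>
      mul_nonneg (le_max_right _ _) (Real.sin_nonneg_of_mem_Icc hθ)) d
  · exact toeplitz_cosMoment_posSemidef hms (fun θ hθ =>
      mul_nonneg (le_max_right _ _) (Real.sin_nonneg_of_mem_Icc hθ)) d
  · intro k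
    simp only [cosMoment]
    rw [← intervalIntegral.integral_sub (hpi _) (hmi _)]
    congr 1
    ext θ
    rw [← mul_sub, ← sub_mul]
    congr 2
    rcases le_total 0 (F (Real.cos θ)) with h | h <;> simp [h]
  · simp only [cosMoment]
    rw [← intervalIntegral.integral_add (hpi _) (hmi _)]
    congr 1
    ext θ
    rw [← mul_add, ← add_mul]
    simp only [Fin.val_zero, Nat.cast_zero, zero_mul, Real.cos_zero, one_mul]
    congr 1
    rcases le_total 0 (F (Real.cos θ)) with h | h <;> simp [h, abs_of_nonneg, abs_of_nonpos]


/-! ### Finite Chebyshev expansions -/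

theorem Polynomial.Sequence.sum_fin_repr_smul (S : Polynomial.Sequence ℝ)
    (hS : ∀ i, IsUnit (S i).leadingCoeff) {P : ℝ[X]} {N : ℕ} (hP : P.degree ≤ N) :
    ∑ n : Fin (N + 1), (S.basis hS).repr P n • S n = P := by
  have hmem := mem_degreeLE.2 hP
  rw [← S.span_degreeLE (m := N) fun i _ => hS i] at hmem
  have hb : ⇑(S.basis hS) = fun i : ℕ => S i :=
    _root_.funext fun i => Polynomial.Sequence.basis_eq_self S hS i
  change P ∈ Submodule.span ℝ ((fun i : ℕ => S i) '' Set.Iic N) at hmem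
  rw [← hb, Module.Basis.mem_span_image] at hmem
  simp only [← Polynomial.Sequence.basis_eq_self S hS]
  rw [← Finset.sum_range (fun n => (S.basis hS).repr P n • S.basis hS n)]
  conv_rhs => rw [← (S.basis hS).linearCombination_repr P, Finsupp.linearCombination_apply]
  refine (Finsupp.sum_of_support_subset _ (fun n hn => ?_) (fun n a => a • S.basis hS n)
    fun _ _ => zero_smul _ _).symm
  have := hmem hn
  simp at this ⊢
  omega

theorem sum_chebTBasis_repr_smul {P : ℝ[X]} {N : ℕ} (hP : P.degree ≤ N) :
    ∑ n : Fin (N + 1), chebTBasis.repr P n • Chebyshev.T ℝ n = P :=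
  (Chebyshev.chebyshevTsequence ℝ).sum_fin_repr_smul _ hP

theorem sum_chebUBasis_repr_smul {P : ℝ[X]} {N : ℕ} (hP : P.degree ≤ N) :
    ∑ n : Fin (N + 1), chebUBasis.repr P n • Chebyshev.U ℝ n = P :=
  chebUSequence.sum_fin_repr_smul _ hP

/-! ### Transplantation to [-1, 1] and the angular variable -/

namespace IntervalUnion

variable {L : ℕ}

theorem eval_transplantPoly (K : IntervalUnion L) (l : Fin L) (P : ℝ[X]) (x : ℝ) :
    (K.transplantPoly l P).eval x = P.eval (((K.b l - K.a l) * x + K.a l + K.b l) / 2) := by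
  simp only [transplantPoly, eval_comp, eval_add, eval_mul, eval_C, eval_X]
  congr 1
  ring

theorem degree_transplantPoly_le (K : IntervalUnion L) (l : Fin L) {P : ℝ[X]} {N : ℕ}
    (hP : P.degree ≤ N) : (K.transplantPoly l P).degree ≤ N := by
  rw [← natDegree_le_iff_degree_le] at hP ⊢
  refine natDegree_comp_le.trans ?_
  exact (Nat.mul_le_mul hP natDegree_linear_le).trans_eq (mul_one N)

theorem W_mulVec_chebTCoeffs (K : IntervalUnion L) {N : ℕ} (l : Fin L) {P : ℝ[X]}
    (hP : P.degree ≤ N) (m : Fin (N + 1)) :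
    (K.W N l).mulVec (chebTCoeffs N P) m = chebUBasis.repr (K.transplantPoly l P) m := by
  conv_rhs => rw [← sum_chebTBasis_repr_smul hP]
  simp only [transplantPoly, sum_comp, smul_comp, map_sum, map_smul, Finsupp.coe_finsetSum,
    Finset.sum_apply, Finsupp.coe_smul, Pi.smul_apply, smul_eq_mul, Matrix.mulVec, dotProduct, W,
    Matrix.of_apply, chebTCoeffs]
  exact Finset.sum_congr rfl fun n _ => mul_comm _ _

/-- The transplanted quotient `Pₗ / wₗ`. -/
noncomputable def quotient (K : IntervalUnion L) (w : ℝ → ℝ) (l : Fin L) (P : ℝ[X]) (x : ℝ) : ℝ :=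
  (K.transplantPoly l P).eval x / K.transplantWeight l w x

variable {K : IntervalUnion L} {w : ℝ → ℝ}

theorem affine_mem_carrier (K : IntervalUnion L) (l : Fin L) {x : ℝ} (hx : x ∈ Set.Icc (-1 : ℝ) 1) :
    ((K.b l - K.a l) * x + K.a l + K.b l) / 2 ∈ K.carrier := by
  have := K.a_lt_b l
  refine Set.mem_iUnion.2 ⟨l, ?_, ?_⟩ <;> nlinarith [hx.1, hx.2]

theorem transplantWeight_pos (hw_pos : ∀ t ∈ K.carrier, 0 < w t) (l : Fin L) {x : ℝ}
    (hx : x ∈ Set.Icc (-1 : ℝ) 1) : 0 < K.transplantWeight l w x :=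
  hw_pos _ (K.affine_mem_carrier l hx)

theorem continuousOn_transplantWeight (hw_cont : ContinuousOn w K.carrier) (l : Fin L) :
    ContinuousOn (K.transplantWeight l w) (Set.Icc (-1) 1) :=
  hw_cont.comp (f := fun x => ((K.b l - K.a l) * x + K.a l + K.b l) / 2)
    (by fun_prop) fun _ hx => K.affine_mem_carrier l hx

theorem continuousOn_quotient (hw_cont : ContinuousOn w K.carrier)
    (hw_pos : ∀ t ∈ K.carrier, 0 < w t) (l : Fin L) (P : ℝ[X]) :
    ContinuousOn (K.quotient w l P) (Set.Icc (-1) 1) :=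
  (K.transplantPoly l P).continuousOn.div (continuousOn_transplantWeight hw_cont l)
    fun _ hx => (transplantWeight_pos hw_pos l hx).ne'

/-- Expanding Pₗ in the Uₙ turns Pₗ(cos θ) sin θ into a sine sum, which is integrated termwise. -/
theorem J_mulVec_W_mulVec (hw_cont : ContinuousOn w K.carrier)
    (hw_pos : ∀ t ∈ K.carrier, 0 < w t) {N : ℕ} (d : ℕ) (l : Fin L) {P : ℝ[X]}
    (hP : P.degree ≤ N) (k : Fin (d + 1)) :
    (K.J w N d l).mulVec ((K.W N l).mulVec (chebTCoeffs N P)) k =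
      cosMoment (fun θ => K.quotient w l P (Real.cos θ) * Real.sin θ) k := by
  have hwc : ContinuousOn (fun θ => K.transplantWeight l w (Real.cos θ)) (Set.uIcc 0 Real.pi) :=
    (continuousOn_transplantWeight hw_cont l).comp Real.continuous_cos.continuousOn
      fun θ _ => Real.cos_mem_Icc θ
  have hw0 : ∀ θ, K.transplantWeight l w (Real.cos θ) ≠ 0 := fun θ =>
    (transplantWeight_pos hw_pos l (Real.cos_mem_Icc θ)).ne'
  rw [funext (K.W_mulVec_chebTCoeffs l hP)]
  simp only [Matrix.mulVec, dotProduct, J, Matrix.of_apply, cosMoment,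
    ← intervalIntegral.integral_mul_const]
  rw [← intervalIntegral.integral_finsetSum]
  · congr 1
    ext θ
    conv_rhs => rw [quotient, ← sum_chebUBasis_repr_smul (K.degree_transplantPoly_le l hP),
      eval_finsetSum, div_mul_eq_mul_div, Finset.sum_mul, mul_div_assoc', Finset.mul_sum,
      Finset.sum_div]
    refine Finset.sum_congr rfl fun n _ => ?_
    have hU := Chebyshev.U_real_cos θ n
    rw [Int.cast_natCast] at hU
    rw [← hU, eval_smul, smul_eq_mul]
    ring
  · intro n _
    refine ContinuousOn.intervalIntegrable (ContinuousOn.mul (ContinuousOn.div ?_ hwc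
      fun θ _ => hw0 θ) continuousOn_const)
    fun_prop

/-- Substitution t = ((bₗ - aₗ) cos θ + aₗ + bₗ)/2; the negative derivative cancels the reversed
orientation. -/
theorem integral_abs_quotient_cos_mul_sin (hw_cont : ContinuousOn w K.carrier)
    (hw_pos : ∀ t ∈ K.carrier, 0 < w t) (l : Fin L) (P : ℝ[X]) :
    (K.b l - K.a l) / 2 *
      ∫ θ in (0 : ℝ)..Real.pi, |K.quotient w l P (Real.cos θ)| * Real.sin θ =
      ∫ t in Set.Icc (K.a l) (K.b l), |P.eval t / w t| := by
  have hab := K.a_lt_b l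
  set f : ℝ → ℝ := fun θ => ((K.b l - K.a l) * Real.cos θ + K.a l + K.b l) / 2 with hf
  have hg : ContinuousOn (fun t => |P.eval t / w t|) K.carrier :=
    (P.continuousOn.div hw_cont fun t ht => (hw_pos t ht).ne').abs
  have h := intervalIntegral.integral_comp_mul_deriv' (a := 0) (b := Real.pi) (f := f)
    (f' := fun θ => -((K.b l - K.a l) / 2 * Real.sin θ)) (g := fun t => |P.eval t / w t|)
    (fun θ _ => by
      have := ((((Real.hasDerivAt_cos θ).const_mul (K.b l - K.a l)).add_const (K.a l)).add_const
        (K.b l)).div_const 2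
      exact this.congr_deriv (by ring)) (by fun_prop) (hg.mono (by
        rintro _ ⟨θ, _, rfl⟩
        exact K.affine_mem_carrier l (Real.cos_mem_Icc θ)))
  have h0 : f 0 = K.b l := by simp [hf]
  have h1 : f Real.pi = K.a l := by simp [hf]; ring
  rw [h0, h1, intervalIntegral.integral_symm (K.a l), intervalIntegral.integral_of_le hab.le,
    ← MeasureTheory.integral_Icc_eq_integral_Ioc] at h
  rw [← neg_eq_iff_eq_neg.mpr h, ← intervalIntegral.integral_neg,
    ← intervalIntegral.integral_const_mul]
  congr 1
  ext θ
  simp only [quotient, eval_transplantPoly, transplantWeight, Function.comp_apply, hf]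
  ring

theorem weightedL1Norm_eq_sum (hw_cont : ContinuousOn w K.carrier)
    (hw_pos : ∀ t ∈ K.carrier, 0 < w t) (P : ℝ[X]) :
    K.weightedL1Norm w P = ∑ l, (K.b l - K.a l) / 2 *
      ∫ θ in (0 : ℝ)..Real.pi, |K.quotient w l P (Real.cos θ)| * Real.sin θ := by
  have hg : ContinuousOn (fun t => |P.eval t / w t|) K.carrier :=
    (P.continuousOn.div hw_cont fun t ht => (hw_pos t ht).ne').abs
  simp only [integral_abs_quotient_cos_mul_sin hw_cont hw_pos]
  refine MeasureTheory.integral_iUnion_fintype (fun _ => measurableSet_Icc) ?_ fun l =>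
    (hg.mono (Set.subset_iUnion (fun l => Set.Icc (K.a l) (K.b l)) l)).integrableOn_Icc
  have key : ∀ l m, l < m → Disjoint (Set.Icc (K.a l) (K.b l)) (Set.Icc (K.a m) (K.b m)) := by
    intro l m h
    exact Set.disjoint_left.2 fun t ht ht' => by linarith [ht.2, ht'.1, K.b_lt_a l m h]
  intro l m hlm
  rcases lt_or_gt_of_ne hlm with h | h
  · exact key l m h
  · exact (key m l h).symm

/-- As deg Pₗ ≤ N ≤ d, the vanishing moments make gₗ orthogonal to Pₗ(cos θ) itself, so ∫ Pₗ(cos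
θ)²/wₗ(cos θ) · sin θ dθ = 0. Hence P vanishes on an interval. -/
theorem eq_zero_of_J_mulVec_eq_zero (hw_cont : ContinuousOn w K.carrier)
    (hw_pos : ∀ t ∈ K.carrier, 0 < w t) {N d : ℕ} (hNd : N ≤ d) (l : Fin L) {P : ℝ[X]}
    (hP : P.degree ≤ N)
    (h : (K.J w N d l).mulVec ((K.W N l).mulVec (chebTCoeffs N P)) = 0) : P = 0 := by
  have hab := K.a_lt_b l
  set R := K.transplantPoly l P with hR
  have hRd : R.degree ≤ N := K.degree_transplantPoly_le l hP
  have hqc : ContinuousOn (fun θ => K.quotient w l P (Real.cos θ)) (Set.uIcc 0 Real.pi) :=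
    (continuousOn_quotient hw_cont hw_pos l P).comp Real.continuous_cos.continuousOn
      fun θ _ => Real.cos_mem_Icc θ
  have hgc : ContinuousOn (fun θ => K.quotient w l P (Real.cos θ) * Real.sin θ)
    (Set.uIcc 0 Real.pi) := hqc.mul Real.continuous_sin.continuousOn
  have hmom : ∀ n : Fin (N + 1),
      cosMoment (fun θ => K.quotient w l P (Real.cos θ) * Real.sin θ) n = 0 := by
    intro n
    have h1 := congrFun h ⟨n, by omega⟩
    rw [J_mulVec_W_mulVec hw_cont hw_pos d l hP] at h1
    exact h1
  have hint : ∫ θ in (0 : ℝ)..Real.pi,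
      R.eval (Real.cos θ) * (K.quotient w l P (Real.cos θ) * Real.sin θ) = 0 := by
    have e : ∀ θ, R.eval (Real.cos θ) * (K.quotient w l P (Real.cos θ) * Real.sin θ) =
        ∑ n : Fin (N + 1), chebTBasis.repr R n *
          (Real.cos (n * θ) * (K.quotient w l P (Real.cos θ) * Real.sin θ)) := by
      intro θ
      conv_lhs => rw [← sum_chebTBasis_repr_smul hRd, eval_finsetSum, Finset.sum_mul]
      refine Finset.sum_congr rfl fun n _ => ?_
      rw [eval_smul, Chebyshev.T_real_cos, smul_eq_mul, Int.cast_natCast, mul_assoc]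
    simp only [e]
    rw [intervalIntegral.integral_finsetSum fun n _ =>
      ContinuousOn.intervalIntegrable (by fun_prop)]
    refine Finset.sum_eq_zero fun n _ => ?_
    rw [intervalIntegral.integral_const_mul]
    exact mul_eq_zero_of_right _ (hmom n)
  have hRz : ∀ θ ∈ Set.Ioo 0 Real.pi, R.eval (Real.cos θ) = 0 := by
    intro θ hθ
    by_contra hne
    have hpos := intervalIntegral.integral_pos (a := 0) (b := Real.pi)
      (f := fun θ => R.eval (Real.cos θ) * (K.quotient w l P (Real.cos θ) * Real.sin θ))
      Real.pi_pos (by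
        rw [← Set.uIcc_of_le Real.pi_pos.le]; fun_prop) (fun t ht => by
        have hw := transplantWeight_pos hw_pos l (Real.cos_mem_Icc t)
        have hs := Real.sin_nonneg_of_mem_Icc (Set.Ioc_subset_Icc_self ht)
        have : R.eval (Real.cos t) * (K.quotient w l P (Real.cos t) * Real.sin t) =
          R.eval (Real.cos t) ^ 2 / K.transplantWeight l w (Real.cos t) * Real.sin t := by
          rw [quotient]; ring
        rw [this]
        positivity) ⟨θ, Set.Ioo_subset_Icc_self hθ, by
        have hw := transplantWeight_pos hw_pos l (Real.cos_mem_Icc θ)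
        have hs := Real.sin_pos_of_mem_Ioo hθ
        have : R.eval (Real.cos θ) * (K.quotient w l P (Real.cos θ) * Real.sin θ) =
          R.eval (Real.cos θ) ^ 2 / K.transplantWeight l w (Real.cos θ) * Real.sin θ := by
          rw [quotient]; ring
        rw [this]
        positivity⟩
    exact hpos.ne' hint
  have hPz : ∀ t ∈ Set.Ioo (K.a l) (K.b l), P.eval t = 0 := by
    intro t ht
    set x := (2 * t - K.a l - K.b l) / (K.b l - K.a l) with hx
    have hba : 0 < K.b l - K.a l := sub_pos.2 hab
    have hx1 : -1 < x := by rw [hx, lt_div_iff₀ hba]; linarith [ht.1]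
    have hx2 : x < 1 := by rw [hx, div_lt_iff₀ hba]; linarith [ht.2]
    have h1 := hRz (Real.arccos x) ⟨Real.arccos_pos.2 hx2, Real.arccos_lt_pi.2 hx1⟩
    rw [Real.cos_arccos hx1.le hx2.le, hR, eval_transplantPoly] at h1
    have : ((K.b l - K.a l) * x + K.a l + K.b l) / 2 = t := by
      rw [hx]; field_simp; ring
    rwa [this] at h1
  exact eq_zero_of_infinite_isRoot P ((Set.Ioo_infinite hab).mono hPz)

end IntervalUnion


/-! ### The semidefinite program: feasibility, attainment, norm, limit -/

namespace IntervalUnion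

variable {L : ℕ} {K : IntervalUnion L} {w : ℝ → ℝ} {N d : ℕ} {P Q : ℝ[X]}
  {yp ym zp zm : Fin L → Fin (d + 1) → ℝ}

theorem chebTCoeffs_add (P Q : ℝ[X]) :
    chebTCoeffs N (P + Q) = chebTCoeffs N P + chebTCoeffs N Q := by
  ext; simp [chebTCoeffs]

theorem chebTCoeffs_smul (c : ℝ) (P : ℝ[X]) :
    chebTCoeffs N (c • P) = c • chebTCoeffs N P := by
  ext; simp [chebTCoeffs]

theorem Feasible.add (hP : K.Feasible w N d P yp ym) (hQ : K.Feasible w N d Q zp zm) :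
    K.Feasible w N d (P + Q) (yp + zp) (ym + zm) := by
  intro l
  refine ⟨?_, (hP l).2.1.add (hQ l).2.1, (hP l).2.2.add (hQ l).2.2⟩
  rw [chebTCoeffs_add, Matrix.mulVec_add, Matrix.mulVec_add, ← (hP l).1, ← (hQ l).1]
  exact add_sub_add_comm _ _ _ _

theorem Feasible.smul (hP : K.Feasible w N d P yp ym) {c : ℝ} (hc : 0 ≤ c) :
    K.Feasible w N d (c • P) (c • yp) (c • ym) := by
  intro l
  refine ⟨?_, (hP l).2.1.smul hc, (hP l).2.2.smul hc⟩
  rw [chebTCoeffs_smul, Matrix.mulVec_smul, Matrix.mulVec_smul, ← (hP l).1]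
  exact (smul_sub c (yp l) (ym l)).symm

theorem Feasible.neg (hP : K.Feasible w N d P yp ym) : K.Feasible w N d (-P) ym yp := by
  intro l
  refine ⟨?_, (hP l).2.2, (hP l).2.1⟩
  rw [← neg_one_smul ℝ P, chebTCoeffs_smul, Matrix.mulVec_smul, Matrix.mulVec_smul, ← (hP l).1,
    neg_one_smul, neg_sub]

/-- The smaller Toeplitz matrices are leading principal submatrices, and the rows of J do not depend
on d. -/
theorem Feasible.truncate {yp ym : Fin L → Fin (d + 2) → ℝ}
    (hP : K.Feasible w N (d + 1) P yp ym) :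
    K.Feasible w N d P (fun l k => yp l k.castSucc) (fun l k => ym l k.castSucc) := by
  intro l
  refine ⟨?_, (hP l).2.1.submatrix Fin.castSucc, (hP l).2.2.submatrix Fin.castSucc⟩
  ext k
  exact congrFun (hP l).1 k.castSucc

theorem Feasible.abs_le (hP : K.Feasible w N d P yp ym) (l : Fin L) (k : Fin (d + 1)) :
    |yp l k| ≤ yp l 0 ∧ |ym l k| ≤ ym l 0 :=
  ⟨abs_apply_le_of_toeplitz_posSemidef (hP l).2.1 k,
    abs_apply_le_of_toeplitz_posSemidef (hP l).2.2 k⟩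

theorem Feasible.zero_le_term (hP : K.Feasible w N d P yp ym) (l : Fin L) :
    0 ≤ (K.b l - K.a l) / 2 * (yp l 0 + ym l 0) := by
  have h := hP.abs_le l 0
  have := K.a_lt_b l
  exact mul_nonneg (by linarith)
    (add_nonneg ((abs_nonneg _).trans h.1) ((abs_nonneg _).trans h.2))

theorem Feasible.objective_nonneg (hP : K.Feasible w N d P yp ym) : 0 ≤ K.objective d yp ym :=
  Finset.sum_nonneg fun l _ => hP.zero_le_term l

theorem Feasible.add_le (hP : K.Feasible w N d P yp ym) (l : Fin L) :
    yp l 0 + ym l 0 ≤ K.objective d yp ym / ((K.b l - K.a l) / 2) := by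
  have := K.a_lt_b l
  rw [le_div_iff₀ (by linarith), mul_comm]
  exact Finset.single_le_sum (f := fun l => (K.b l - K.a l) / 2 * (yp l 0 + ym l 0))
    (fun l _ => hP.zero_le_term l) (Finset.mem_univ l)

theorem bddBelow_feasibleValues : BddBelow (K.feasibleValues w N d P) :=
  ⟨0, by rintro _ ⟨yp, ym, h, rfl⟩; exact h.objective_nonneg⟩

theorem weightedL1Norm_mem_feasibleValues (hw_cont : ContinuousOn w K.carrier)
    (hw_pos : ∀ t ∈ K.carrier, 0 < w t) (d : ℕ) (hP : P.degree ≤ N) :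
    K.weightedL1Norm w P ∈ K.feasibleValues w N d P := by
  choose yp ym hp hm hv h0 using fun l =>
    exists_toeplitz_posSemidef_cosMoment (continuousOn_quotient hw_cont hw_pos l P) d
  refine ⟨yp, ym, fun l => ⟨?_, hp l, hm l⟩, ?_⟩
  · ext k
    rw [J_mulVec_W_mulVec hw_cont hw_pos d l hP]
    exact hv l k
  · rw [weightedL1Norm_eq_sum hw_cont hw_pos]
    exact Finset.sum_congr rfl fun l _ => by rw [h0]

theorem isClosed_setOf_feasible : IsClosed {y : (Fin L → Fin (d + 1) → ℝ) ×
    (Fin L → Fin (d + 1) → ℝ) | K.Feasible w N d P y.1 y.2} := by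
  simp only [Feasible, Set.ofPred_forall]
  refine isClosed_iInter fun l => ?_
  have h1 : Continuous fun y : (Fin L → Fin (d + 1) → ℝ) × (Fin L → Fin (d + 1) → ℝ) => y.1 l :=
    by fun_prop
  have h2 : Continuous fun y : (Fin L → Fin (d + 1) → ℝ) × (Fin L → Fin (d + 1) → ℝ) => y.2 l :=
    by fun_prop
  exact (isClosed_eq (h1.sub h2) continuous_const).inter
    (((isClosed_setOf_toeplitz_posSemidef d).preimage h1).inter
      ((isClosed_setOf_toeplitz_posSemidef d).preimage h2))

/-- The objective bounds each y₀, which bounds every other entry; a sublevel set is therefore closed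
in a box, and the continuous objective attains its minimum there. -/
theorem isLeast_ersatzNorm (hne : (K.feasibleValues w N d P).Nonempty) :
    IsLeast (K.feasibleValues w N d P) (K.ersatzNorm w N d P) := by
  obtain ⟨_, yp₀, ym₀, h₀, rfl⟩ := hne
  set R : Fin L → Fin (d + 1) → ℝ := fun l _ =>
    K.objective d yp₀ ym₀ / ((K.b l - K.a l) / 2) with hR
  have hobj : Continuous fun y : (Fin L → Fin (d + 1) → ℝ) × (Fin L → Fin (d + 1) → ℝ) =>
      K.objective d y.1 y.2 := by
    unfold objective
    fun_prop
  set S : Set ((Fin L → Fin (d + 1) → ℝ) × (Fin L → Fin (d + 1) → ℝ)) :=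
    {y | K.Feasible w N d P y.1 y.2} ∩ {y | K.objective d y.1 y.2 ≤ K.objective d yp₀ ym₀} with hS
  have hSc : IsCompact S := by
    refine (isCompact_Icc (a := ((-R, -R) : (Fin L → Fin (d + 1) → ℝ) × (Fin L → Fin (d + 1) → ℝ)))
      (b := (R, R))).of_isClosed_subset
      (isClosed_setOf_feasible.inter (isClosed_le hobj continuous_const)) ?_
    rintro ⟨yp, ym⟩ ⟨hf, ho⟩
    have key : ∀ l k, |yp l k| ≤ R l k ∧ |ym l k| ≤ R l k := by
      intro l k
      have h1 := hf.abs_le l k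
      -- Supplies y₀ ≥ 0 for both signs, so that each y₀ is at most their sum.
      have h2 := hf.abs_le l 0
      have h3 := hf.add_le l
      have h4 : K.objective d yp ym / ((K.b l - K.a l) / 2) ≤ R l k := by
        have := K.a_lt_b l
        exact div_le_div_of_nonneg_right ho (by linarith)
      simp only at h1 h2 h3
      constructor
      · linarith [h1.1, (abs_nonneg _).trans h2.2]
      · linarith [h1.2, (abs_nonneg _).trans h2.1]
    exact ⟨⟨fun l k => (_root_.abs_le.1 (key l k).1).1, fun l k => (_root_.abs_le.1 (key l k).2).1⟩,
      ⟨fun l k => (_root_.abs_le.1 (key l k).1).2, fun l k => (_root_.abs_le.1 (key l k).2).2⟩⟩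
  obtain ⟨y, hyS, hy⟩ := hSc.exists_isMinOn ⟨(yp₀, ym₀), h₀, le_refl (K.objective d yp₀ ym₀)⟩ hobj.continuousOn
  have hleast : IsLeast (K.feasibleValues w N d P) (K.objective d y.1 y.2) := by
    refine ⟨⟨y.1, y.2, hyS.1, rfl⟩, ?_⟩
    rintro _ ⟨zp, zm, hz, rfl⟩
    by_cases h : K.objective d zp zm ≤ K.objective d yp₀ ym₀
    · exact hy (show (zp, zm) ∈ S from ⟨hz, h⟩)
    · exact hyS.2.trans (not_le.1 h).le
  rw [ersatzNorm, hleast.csInf_eq]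
  exact hleast

theorem objective_add : K.objective d (yp + zp) (ym + zm) =
    K.objective d yp ym + K.objective d zp zm := by
  simp only [objective, ← Finset.sum_add_distrib, Pi.add_apply]
  exact Finset.sum_congr rfl fun l _ => by ring

theorem objective_smul (c : ℝ) : K.objective d (c • yp) (c • ym) = c * K.objective d yp ym := by
  simp only [objective, Finset.mul_sum, Pi.smul_apply, smul_eq_mul]
  exact Finset.sum_congr rfl fun l _ => by ring

theorem objective_swap : K.objective d ym yp = K.objective d yp ym := by
  simp only [objective, add_comm]

theorem Feasible.ersatzNorm_le (hP : K.Feasible w N d P yp ym) :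
    K.ersatzNorm w N d P ≤ K.objective d yp ym :=
  csInf_le bddBelow_feasibleValues ⟨yp, ym, hP, rfl⟩

theorem isLeast_ersatzNorm_of_degree_le (hw_cont : ContinuousOn w K.carrier)
    (hw_pos : ∀ t ∈ K.carrier, 0 < w t) (d : ℕ) (hP : P.degree ≤ N) :
    IsLeast (K.feasibleValues w N d P) (K.ersatzNorm w N d P) :=
  isLeast_ersatzNorm ⟨_, weightedL1Norm_mem_feasibleValues hw_cont hw_pos d hP⟩

theorem ersatzNorm_smul_le (hw_cont : ContinuousOn w K.carrier)
    (hw_pos : ∀ t ∈ K.carrier, 0 < w t) (d : ℕ) (hP : P.degree ≤ N) (c : ℝ) :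
    K.ersatzNorm w N d (c • P) ≤ |c| * K.ersatzNorm w N d P := by
  obtain ⟨yp, ym, hf, hv⟩ := (isLeast_ersatzNorm_of_degree_le hw_cont hw_pos d hP).1
  rw [hv, ← objective_smul]
  rcases le_total 0 c with hc | hc
  · rw [abs_of_nonneg hc]
    exact (hf.smul hc).ersatzNorm_le
  · rw [abs_of_nonpos hc, ← objective_swap]
    have := (hf.smul (neg_nonneg.2 hc)).neg
    rw [neg_smul, neg_neg] at this
    exact this.ersatzNorm_le

theorem isVectorNorm_ersatzNorm (hw_cont : ContinuousOn w K.carrier)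
    (hw_pos : ∀ t ∈ K.carrier, 0 < w t) (hNd : N ≤ d) :
    IsVectorNorm (fun P : degreeLE ℝ (N : WithBot ℕ) => K.ersatzNorm w N d (P : ℝ[X])) := by
  have hleast : ∀ P : degreeLE ℝ (N : WithBot ℕ), IsLeast (K.feasibleValues w N d (P : ℝ[X]))
      (K.ersatzNorm w N d (P : ℝ[X])) := fun P =>
    isLeast_ersatzNorm_of_degree_le hw_cont hw_pos d (mem_degreeLE.1 P.2)
  have hsmul : ∀ (c : ℝ) (P : degreeLE ℝ (N : WithBot ℕ)),
      K.ersatzNorm w N d (c • (P : ℝ[X])) ≤ |c| * K.ersatzNorm w N d (P : ℝ[X]) := fun c P =>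
    ersatzNorm_smul_le hw_cont hw_pos d (mem_degreeLE.1 P.2) c
  have hnonneg : ∀ P : degreeLE ℝ (N : WithBot ℕ), 0 ≤ K.ersatzNorm w N d (P : ℝ[X]) := by
    intro P
    obtain ⟨yp, ym, hf, hv⟩ := (hleast P).1
    rw [hv]
    exact hf.objective_nonneg
  refine ⟨hnonneg, fun P => ⟨fun h => ?_, fun h => ?_⟩, fun c P => ?_, fun P Q => ?_⟩
  · obtain ⟨yp, ym, hf, hv⟩ := (hleast P).1
    rw [show K.ersatzNorm w N d (P : ℝ[X]) = 0 from h] at hv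
    -- One interval is enough to force P = 0.
    have l : Fin L := ⟨0, K.pos⟩
    have h1 := hf.add_le l
    rw [← hv, zero_div] at h1
    have h2 : ∀ k, yp l k - ym l k = 0 := by
      intro k
      have h3 := hf.abs_le l k
      have h4 := abs_nonneg (yp l k)
      have h5 := abs_nonneg (ym l k)
      have h6 : |yp l k| = 0 := by linarith
      have h7 : |ym l k| = 0 := by linarith
      rw [abs_eq_zero.1 h6, abs_eq_zero.1 h7, sub_zero]
    refine Subtype.ext (eq_zero_of_J_mulVec_eq_zero hw_cont hw_pos hNd l (mem_degreeLE.1 P.2) ?_)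
    rw [← (hf l).1]
    exact funext h2
  · have := hsmul 0 P
    simp only [zero_smul, abs_zero, zero_mul] at this
    subst h
    exact le_antisymm this (hnonneg 0)
  · refine le_antisymm (hsmul c P) ?_
    rcases eq_or_ne c 0 with rfl | hc
    · rw [abs_zero, zero_mul]
      exact hnonneg _
    -- The reverse inequality is the same bound applied to c⁻¹ and cP.
    · have h := hsmul c⁻¹ (c • P)
      simp only [Submodule.coe_smul, inv_smul_smul₀ hc, abs_inv] at h
      rwa [inv_mul_eq_div, le_div_iff₀ (abs_pos.2 hc), mul_comm] at h
  · obtain ⟨yp, ym, hf, hv⟩ := (hleast P).1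
    obtain ⟨zp, zm, hg, hu⟩ := (hleast Q).1
    simp only [hv, hu, ← objective_add]
    exact (hf.add hg).ersatzNorm_le

theorem tendsto_ersatzNorm (hw_cont : ContinuousOn w K.carrier)
    (hw_pos : ∀ t ∈ K.carrier, 0 < w t) (hP : P.degree ≤ N) :
    Tendsto (fun d : ℕ => K.ersatzNorm w N d P) atTop (𝓝 (K.weightedL1Norm w P)) := by
  set B := ∑ l, (K.b l - K.a l) / 2 with hB
  have hB0 : 0 ≤ B := Finset.sum_nonneg fun l _ => by linarith [K.a_lt_b l]
  rw [Metric.tendsto_atTop']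
  intro ε hε
  -- The interval errors, weighted by half-lengths, total Bε/(B+1), which is strictly below ε.
  have hδ : 0 < ε / (B + 1) := by positivity
  have hev := eventually_all.2 fun l : Fin L =>
    eventually_integral_abs_sub_le (continuousOn_quotient hw_cont hw_pos l P) hδ
  obtain ⟨n, hn⟩ := eventually_atTop.1 hev
  refine ⟨n, fun d hd => ?_⟩
  have hle : K.ersatzNorm w N d P ≤ K.weightedL1Norm w P :=
    csInf_le bddBelow_feasibleValues (weightedL1Norm_mem_feasibleValues hw_cont hw_pos d hP)
  obtain ⟨yp, ym, hf, hv⟩ := (isLeast_ersatzNorm_of_degree_le hw_cont hw_pos d hP).1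
  have hge : K.weightedL1Norm w P - B * (ε / (B + 1)) ≤ K.ersatzNorm w N d P := by
    rw [hv, weightedL1Norm_eq_sum hw_cont hw_pos, hB, Finset.sum_mul, ← Finset.sum_sub_distrib]
    refine Finset.sum_le_sum fun l _ => ?_
    rw [← mul_sub]
    refine mul_le_mul_of_nonneg_left ?_ (by linarith [K.a_lt_b l])
    refine hn d hd.le l (yp l) (ym l) (hf l).2.1 (hf l).2.2 fun k => ?_
    rw [← J_mulVec_W_mulVec hw_cont hw_pos d l hP, ← (hf l).1]
    rfl
  have hlt : B * (ε / (B + 1)) < ε := by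
    rw [mul_div_assoc', div_lt_iff₀ (by positivity)]
    nlinarith
  rw [Real.dist_eq, abs_sub_comm, abs_of_nonneg (by linarith)]
  linarith

end IntervalUnion

open IntervalUnion in
theorem mainTheorem2 {L : ℕ} (K : IntervalUnion L) (w : ℝ → ℝ)
    (hw_cont : ContinuousOn w K.carrier) (hw_pos : ∀ t ∈ K.carrier, 0 < w t) (N : ℕ) :
    (∀ d : ℕ, N ≤ d →
      (∀ P ∈ degreeLE ℝ (N : WithBot ℕ),
        IsLeast (K.feasibleValues w N d P) (K.ersatzNorm w N d P)) ∧
      IsVectorNorm (fun P : degreeLE ℝ (N : WithBot ℕ) => K.ersatzNorm w N d (P : ℝ[X]))) ∧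
    (∀ P ∈ degreeLE ℝ (N : WithBot ℕ),
      (∀ d : ℕ, N ≤ d →
        K.ersatzNorm w N d P ≤ K.ersatzNorm w N (d + 1) P ∧
        K.ersatzNorm w N d P ≤ K.weightedL1Norm w P) ∧
      Tendsto (fun d : ℕ => K.ersatzNorm w N d P) atTop (𝓝 (K.weightedL1Norm w P))) := by
  refine ⟨fun d hd => ⟨fun P hP => ?_, isVectorNorm_ersatzNorm hw_cont hw_pos hd⟩,
    fun P hP => ⟨fun d _ => ⟨?_, ?_⟩, tendsto_ersatzNorm hw_cont hw_pos (mem_degreeLE.1 hP)⟩⟩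
  · exact isLeast_ersatzNorm_of_degree_le hw_cont hw_pos d (mem_degreeLE.1 hP)
  · obtain ⟨yp, ym, hf, hv⟩ :=
      (isLeast_ersatzNorm_of_degree_le hw_cont hw_pos (d + 1) (mem_degreeLE.1 hP)).1
    rw [hv]
    exact hf.truncate.ersatzNorm_le
  · exact csInf_le bddBelow_feasibleValues
      (weightedL1Norm_mem_feasibleValues hw_cont hw_pos d (mem_degreeLE.1 hP))
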